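/- Let $0<p<1$. In the Superstar Model with parameter $p$ the random graphs $G_1,G_2,\dots$ grow as follows. $G_1$ consists of the single vertex $v_0$ (the superstar), and $G_2$ consists of $v_0$, a non-superstar $v_1$, and an edge between them. For $n\ge 2$, given $G_1,\dots,G_n$, the graph $G_{n+1}$ arises from $G_n$ by adding a new vertex $v_n$ and a single edge from $v_n$ to a vertex of $G_n$: this vertex is $v_0$ with probability $p$, and it is $v_i$ ($1\le i\le n-1$) with probability $(1-p)\deg(v_i,G_n)\big/\sum_{j=1}^{n-1}\deg(v_j,G_n)$. All the $G_n$ are defined on one probability space. Then, with probability one, for every integer $k\ge 1$, $$\lim_{n\to\infty}\frac1n\,\mathrm{card}\{1\le j\le n:\deg(v_j,G_{n+1})=k\}=\nu_{SM}(k,p),$$ where $$\nu_{SM}(k,p)=\frac{2-p}{1-p}\,(k-1)!\prod_{i=1}^{k}\Bigl(i+\frac{2-p}{1-p}\Bigr)^{-1}.$$ Moreover $\nu_{SM}(\cdot,p)$ is a probability mass function on $\{1,2,3,\dots\}$, and it is a power law with exponent $\alpha=(3-2p)/(1-p)$: as $k\to\infty$, $$\nu_{SM}(k,p)\sim \frac{2-p}{1-p}\,\Gamma(\alpha)\,k^{-\alpha}.$$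 -/

import Mathlib

open MeasureTheory Filter Topology Asymptotics
open scoped Nat

namespace Superstar

/-- Degree of the vertex `v` in the graph `g` on the vertices `0, …, n - 1`. -/
noncomputable def deg {n : ℕ} (g : SimpleGraph (Fin n)) (v : Fin n) : ℕ := by
  classical exact g.degree v

/-- The graph obtained from `g` (on the vertices `v_0, …, v_{n-1}`) by adding one new vertex `v_n`
together with the single edge joining it to `v_i`. -/
def attach {n : ℕ} (g : SimpleGraph (Fin n)) (i : Fin n) : SimpleGraph (Fin (n + 1)) :=
  g.map Fin.castSucc ⊔ SimpleGraph.edge i.castSucc (Fin.last n)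

/-- Total degree of the non-superstar vertices `v_1, …, v_{n-1}` of `g`; the superstar is `v_0`. -/
noncomputable def nonSuperstarDegreeSum {n : ℕ} (g : SimpleGraph (Fin n)) : ℕ :=
  ∑ j ∈ Finset.univ.filter (fun j : Fin n => (j : ℕ) ≠ 0), deg g j

/-- Probability that the next vertex is attached to `v_i` when the current graph is `g`:
the superstar `v_0` is chosen with probability `p`, and with probability `1 - p` a non-superstar is
chosen with probability proportional to its degree in `g`. -/
noncomputable def attachProb (p : ℝ) {n : ℕ} (g : SimpleGraph (Fin n)) (i : Fin n) : ℝ :=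
  if (i : ℕ) = 0 then p else (1 - p) * ((deg g i : ℝ) / (nonSuperstarDegreeSum g : ℝ))

/-- The graph process `(G_n)`, where `G_n` has the vertices `v_0, …, v_{n-1}`, follows the Superstar
Model with parameter `p` under `μ`. The graph `G_1` is a single vertex (the only simple graph on
`Fin 1`), `G_2` is a single edge, and for `n ≥ 2`, given the history `G_1 = h 1, …, G_n = h n`,
the graph `G_{n+1}` arises from `G_n` by attaching `v_n` to `v_i` with probability
`attachProb p (h n) i`. The graph `G 0` has no vertices and carries no information. -/
structure IsSuperstarProcess {Ω : Type*} [MeasurableSpace Ω] (μ : Measure Ω) (p : ℝ)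
    (G : (n : ℕ) → Ω → SimpleGraph (Fin n)) : Prop where
  measurableSet_eq : ∀ (n : ℕ) (g : SimpleGraph (Fin n)), MeasurableSet {ω | G n ω = g}
  two : ∀ᵐ ω ∂μ, G 2 ω = ⊤
  step : ∀ n : ℕ, 2 ≤ n → ∀ (h : (m : ℕ) → SimpleGraph (Fin m)) (i : Fin n),
    μ {ω | (∀ m ≤ n, G m ω = h m) ∧ G (n + 1) ω = attach (h n) i} =
      μ {ω | ∀ m ≤ n, G m ω = h m} * ENNReal.ofReal (attachProb p (h n) i)

/-- Number of non-superstar vertices of `g` that have degree `k`. -/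
noncomputable def nonSuperstarCount {n : ℕ} (g : SimpleGraph (Fin n)) (k : ℕ) : ℕ :=
  {j : Fin n | (j : ℕ) ≠ 0 ∧ deg g j = k}.ncard

/-- The limiting degree distribution, meant for `k ≥ 1`. -/
noncomputable def nuSM (k : ℕ) (p : ℝ) : ℝ :=
  (2 - p) / (1 - p) * ((k - 1)! : ℝ) * ∏ i ∈ Finset.Icc 1 k, ((i : ℝ) + (2 - p) / (1 - p))⁻¹

end Superstar

/-! Write S for the total non-superstar degree and N_k for the number of non-superstars of degree k.
Given the past, S grows on average by 2 - p: the new vertex contributes 1, and the chosen vertex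
contributes 1 unless it is the superstar. N_{k+1} changes on average by (1-p) k N_k / S - (1-p)(k+1)
N_{k+1} / S, plus 1 when k = 0.

The actual increments differ from these means by innovations, which are bounded and pairwise
orthogonal. `ae_tendsto_sum_div_of_orthogonal` makes their averages vanish almost surely, by second
moments alone and without martingale convergence. What remains is pathwise:
`tendsto_div_of_recursion` solves the noisy linear recursion, first for S (S/n tends to 2 - p), then
for N_{k+1} by induction on k. The limits obey the recursion `nuSM_succ`.

With a = (2-p)/(1-p), the limit law telescopes, so its total mass is 1, and Euler's limit for Γ
gives the power law. -/

namespace Superstar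

/-! ### Linear recursions with noise, and a strong law. -/

/-- Limit of `x n / n` for a linear recursion with averaging noise. -/
theorem tendsto_div_of_recursion {x b c ε : ℕ → ℝ} {b₀ c₀ : ℝ} (hc0 : 0 ≤ c₀)
    (hc : ∀ n, 0 ≤ c n) (hcl : Tendsto (fun n : ℕ => (n : ℝ) * c n) atTop (𝓝 c₀))
    (hb : Tendsto b atTop (𝓝 b₀))
    (hε : Tendsto (fun n : ℕ => (∑ i ∈ Finset.range n, ε i) / (n : ℝ)) atTop (𝓝 0))
    (hx : ∀ n, x (n + 1) = x n + b n - c n * x n + ε n) :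
    Tendsto (fun n : ℕ => x n / (n : ℝ)) atTop (𝓝 (b₀ / (1 + c₀))) := by
  set l := b₀ / (1 + c₀) with hl
  set M : ℕ → ℝ := fun n => ∑ i ∈ Finset.range n, ε i with hM
  -- The slope `l` solves `b₀ - l - c₀ * l = 0`. Removing both the line `l * n` and the accumulated
  -- noise leaves a recursion driven by `δ → 0`.
  set u : ℕ → ℝ := fun n => x n - l * n - M n with hu
  set δ : ℕ → ℝ := fun n => b n - l - (n * c n) * (l + M n / n) with hδ
  have hrec : ∀ n, u (n + 1) = (1 - c n) * u n + δ n := by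
    intro n
    have h1 : M (n + 1) = M n + ε n := Finset.sum_range_succ _ _
    have h2 : (n * c n) * (l + M n / n) = c n * (l * n + M n) := by
      rcases Nat.eq_zero_or_pos n with rfl | hn
      · simp [hM]
      · have : (n : ℝ) ≠ 0 := by positivity
        field_simp
    simp only [hu, hδ, h1, h2, hx]
    push_cast
    ring
  have hδ0 : Tendsto δ atTop (𝓝 0) := by
    have h := (hb.sub_const l).sub (hcl.mul (hε.const_add l))
    have h3 : b₀ - l - c₀ * (l + 0) = 0 := by
      rw [hl]; field_simp; ring
    rwa [h3] at h
  -- From some `N` on, `1 - c n` lies in [0, 1], so |u| grows by at most `|δ n|` per step; a Cesàro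
  -- mean then gives `u n / n → 0`.
  have hc1 : ∀ᶠ n in atTop, c n ≤ 1 := by
    have h1 : Tendsto (fun n : ℕ => (n : ℝ) * c n * (n : ℝ)⁻¹) atTop (𝓝 (c₀ * 0)) :=
      hcl.mul tendsto_inv_atTop_nhds_zero_nat
    rw [mul_zero] at h1
    filter_upwards [h1.eventually (ge_mem_nhds one_pos), eventually_gt_atTop 0] with n hn hn0
    have : (n : ℝ) ≠ 0 := by positivity
    rwa [mul_comm, ← mul_assoc, inv_mul_cancel₀ this, one_mul] at hn
  obtain ⟨N, hN⟩ := eventually_atTop.1 hc1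
  have hbound : ∀ n, N ≤ n → |u n| ≤ |u N| + ∑ i ∈ Finset.range n, |δ i| := by
    intro n hn
    induction n, hn using Nat.le_induction with
    | base => exact le_add_of_nonneg_right (Finset.sum_nonneg fun _ _ => abs_nonneg _)
    | succ n hn ih =>
      rw [Finset.sum_range_succ, hrec]
      have h1 := abs_add_le ((1 - c n) * u n) (δ n)
      have h2 : |(1 - c n) * u n| ≤ |u n| := by
        rw [abs_mul, abs_of_nonneg (by linarith [hN n hn])]
        exact mul_le_of_le_one_left (abs_nonneg _) (by linarith [hc n])
      linarith
  have hces : Tendsto (fun n : ℕ => |u N| * (n : ℝ)⁻¹ + (n : ℝ)⁻¹ * ∑ i ∈ Finset.range n, |δ i|)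
      atTop (𝓝 0) := by
    have h1 : Tendsto (fun n => |δ n|) atTop (𝓝 0) := by simpa using hδ0.abs
    simpa using (tendsto_inv_atTop_nhds_zero_nat.const_mul |u N|).add h1.cesaro
  have hu0 : Tendsto (fun n : ℕ => u n / n) atTop (𝓝 0) := by
    refine squeeze_zero_norm' ?_ hces
    filter_upwards [eventually_ge_atTop N] with n hn
    rw [Real.norm_eq_abs, abs_div, Nat.abs_cast, div_eq_mul_inv, mul_comm (n : ℝ)⁻¹, ← add_mul]
    exact mul_le_mul_of_nonneg_right (hbound n hn) (by positivity)
  have hfin := (hu0.add hε).const_add l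
  rw [add_zero, add_zero] at hfin
  refine hfin.congr' ?_
  filter_upwards [eventually_gt_atTop 0] with n hn
  have : (n : ℝ) ≠ 0 := by positivity
  simp only [hu]
  field_simp
  ring

/-- Strong law for partial sums of bounded, pairwise orthogonal random variables. -/
theorem ae_tendsto_sum_div_of_orthogonal {Ω : Type*} [MeasurableSpace Ω] {μ : Measure Ω}
    [IsProbabilityMeasure μ] {D : ℕ → Ω → ℝ} {C : ℝ} (hmeas : ∀ n, Measurable (D n))
    (hC : ∀ n, ∀ᵐ ω ∂μ, |D n ω| ≤ C)
    (horth : ∀ i j, i < j → ∫ ω, D i ω * D j ω ∂μ = 0) :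
    ∀ᵐ ω ∂μ, Tendsto (fun n : ℕ => (∑ i ∈ Finset.range n, D i ω) / (n : ℝ)) atTop (𝓝 0) := by
  set M : ℕ → Ω → ℝ := fun n ω => ∑ i ∈ Finset.range n, D i ω with hM
  have hMmeas : ∀ n, Measurable (M n) := fun n => Finset.measurable_fun_sum _ fun i _ => hmeas i
  have hC0 : 0 ≤ C := by
    obtain ⟨ω, hω⟩ := (hC 0).exists
    exact (abs_nonneg _).trans hω
  have hprod : ∀ i j, ∀ᵐ ω ∂μ, ‖D i ω * D j ω‖ ≤ C * C := by
    intro i j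
    filter_upwards [hC i, hC j] with ω hi hj
    rw [Real.norm_eq_abs, abs_mul]
    exact mul_le_mul hi hj (abs_nonneg _) hC0
  have hint : ∀ i j, Integrable (fun ω => D i ω * D j ω) μ := fun i j =>
    Integrable.of_bound ((hmeas i).mul (hmeas j)).aestronglyMeasurable (C * C) (hprod i j)
  have hsq : ∀ n ω, M n ω ^ 2 = ∑ i ∈ Finset.range n, ∑ j ∈ Finset.range n, D i ω * D j ω := by
    intro n ω
    rw [sq, hM, Finset.sum_mul_sum]
  have hMint : ∀ n, Integrable (fun ω => M n ω ^ 2) μ := by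
    intro n
    simp only [hsq]
    exact integrable_finsetSum _ fun i _ => integrable_finsetSum _ fun j _ => hint i j
  have hvar : ∀ n, ∫ ω, M n ω ^ 2 ∂μ ≤ n * (C * C) := by
    intro n
    simp only [hsq]
    rw [integral_finsetSum _ fun i _ => integrable_finsetSum _ fun j _ => hint i j]
    have h1 : ∀ i ∈ Finset.range n,
        ∫ ω, ∑ j ∈ Finset.range n, D i ω * D j ω ∂μ ≤ C * C := by
      intro i hi
      rw [integral_finsetSum _ fun j _ => hint i j, Finset.sum_eq_single_of_mem i hi]
      · have := norm_integral_le_of_norm_le_const (hprod i i)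
        rw [probReal_univ, mul_one] at this
        exact (le_abs_self _).trans this
      · intro j _ hj
        rcases lt_or_gt_of_ne hj with h | h
        · rw [← horth j i h]
          exact integral_congr_ae (Eventually.of_forall fun ω => mul_comm _ _)
        · exact horth i j h
    calc _ ≤ ∑ _i ∈ Finset.range n, C * C := Finset.sum_le_sum h1
      _ = n * (C * C) := by simp
  -- Along squares the second moment of the average is at most C²/m², which is summable.
  have hsub : ∀ᵐ ω ∂μ, Tendsto (fun m : ℕ => M (m ^ 2) ω / (m : ℝ) ^ 2) atTop (𝓝 0) := by
    set X : ℕ → Ω → ℝ := fun m ω => (M (m ^ 2) ω / (m : ℝ) ^ 2) ^ 2 with hX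
    have hXmeas : ∀ m, Measurable (X m) := fun m => ((hMmeas _).div_const _).pow_const 2
    have hXint : ∀ m, ∫⁻ ω, ENNReal.ofReal (X m ω) ∂μ ≤
        ENNReal.ofReal (C * C * (1 / (m : ℝ) ^ 2)) := by
      intro m
      have hXm : X m = fun ω => M (m ^ 2) ω ^ 2 * (1 / (m : ℝ) ^ 4) := by
        funext ω
        simp only [hX]
        ring
      rw [← ofReal_integral_eq_lintegral_ofReal (by change Integrable (X m) μ; rw [hXm]; exact (hMint _).mul_const _)
        (Eventually.of_forall fun ω => sq_nonneg _)]
      refine ENNReal.ofReal_le_ofReal ?_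
      change ∫ ω, X m ω ∂μ ≤ _
      rw [hXm, integral_mul_const]
      rcases Nat.eq_zero_or_pos m with rfl | hm
      · simp
      · have hm' : (m : ℝ) ≠ 0 := by positivity
        refine (mul_le_mul_of_nonneg_right (hvar (m ^ 2)) (by positivity)).trans (le_of_eq ?_)
        push_cast
        field_simp
    have hfin : ∫⁻ ω, ∑' m, ENNReal.ofReal (X m ω) ∂μ ≠ ⊤ := by
      rw [lintegral_tsum fun m => (hXmeas m).ennreal_ofReal.aemeasurable]
      refine ne_top_of_le_ne_top ?_ (ENNReal.tsum_le_tsum hXint)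
      exact ((Real.summable_one_div_nat_pow.2 one_lt_two).mul_left (C * C)).tsum_ofReal_ne_top
    filter_upwards [ae_lt_top (Measurable.tsum fun m => (hXmeas m).ennreal_ofReal) hfin]
      with ω hω
    have h1 := ENNReal.tendsto_atTop_zero_of_tsum_ne_top hω.ne
    have h2 := (ENNReal.tendsto_toReal ENNReal.zero_ne_top).comp h1
    have h3 : Tendsto (fun m => X m ω) atTop (𝓝 0) := by
      refine h2.congr fun m => ?_
      exact ENNReal.toReal_ofReal (sq_nonneg _)
    have h4 := h3.sqrt
    rw [Real.sqrt_zero] at h4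
    refine (tendsto_zero_iff_abs_tendsto_zero _).2 (h4.congr fun m => ?_)
    exact Real.sqrt_sq_eq_abs _
  filter_upwards [hsub, ae_all_iff.2 hC] with ω hω hCω
  -- Between squares: `n` exceeds `n.sqrt ^ 2` by at most `2 * n.sqrt`, so bounded terms change the
  -- sum by a negligible amount.
  have hdiff : ∀ m n, m ≤ n → |M n ω - M m ω| ≤ C * (n - m : ℝ) := by
    intro m n hmn
    induction n, hmn using Nat.le_induction with
    | base => simp
    | succ n hn ih =>
      have h1 : M (n + 1) ω = M n ω + D n ω := Finset.sum_range_succ _ _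
      have h2 := abs_add_le (M n ω - M m ω) (D n ω)
      rw [h1, show M n ω + D n ω - M m ω = M n ω - M m ω + D n ω by ring]
      push_cast
      linarith [hCω n]
  have hsqrt : Tendsto Nat.sqrt atTop atTop :=
    tendsto_atTop_mono' _ (Eventually.of_forall fun n => le_rfl)
      (tendsto_atTop_atTop.2 fun b => ⟨b * b, fun n hn => Nat.le_sqrt.2 hn⟩)
  have hlim : Tendsto (fun n : ℕ => |M (n.sqrt ^ 2) ω / (n.sqrt : ℝ) ^ 2| +
      2 * C * (n.sqrt : ℝ)⁻¹) atTop (𝓝 0) := by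
    have h1 := (hω.abs.add (tendsto_inv_atTop_nhds_zero_nat.const_mul (2 * C))).comp hsqrt
    simpa [Function.comp_def] using h1
  refine squeeze_zero_norm' ?_ hlim
  filter_upwards [eventually_gt_atTop 0] with n hn
  set s := n.sqrt
  have hs0 : 0 < s := Nat.sqrt_pos.2 hn
  have hs1 : s ^ 2 ≤ n := Nat.sqrt_le' n
  have hs2 : n ≤ s ^ 2 + 2 * s := by
    have := Nat.sqrt_le_add n
    simp only [s]; nlinarith
  have hs1' : (s : ℝ) ^ 2 ≤ n := by exact_mod_cast hs1
  have hs2' : (n : ℝ) ≤ s ^ 2 + 2 * s := by exact_mod_cast hs2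
  have hs0' : (0 : ℝ) < s := by exact_mod_cast hs0
  have hd := hdiff _ _ hs1
  push_cast at hd
  have hd' : |M n ω| ≤ |M (s ^ 2) ω| + 2 * C * s := by
    have h1 := abs_sub_abs_le_abs_sub (M n ω) (M (s ^ 2) ω)
    nlinarith
  rw [Real.norm_eq_abs, abs_div, Nat.abs_cast]
  calc |M n ω| / n ≤ (|M (s ^ 2) ω| + 2 * C * s) / (s : ℝ) ^ 2 := by gcongr
    _ = _ := by
      rw [abs_div, abs_of_nonneg (sq_nonneg (s : ℝ))]
      field_simp

/-! ### The limiting distribution: total mass, tail and recursion. -/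

/-- Euler's limit for Γ(a), multiplied by a to cancel the factor i = 0 of its denominator. It serves
both the total mass and the tail. -/
theorem tendsto_rpow_mul_factorial_mul_prod {a : ℝ} (ha : 0 < a) :
    Tendsto (fun n : ℕ => (n : ℝ) ^ a * ((n ! : ℝ) * ∏ i ∈ Finset.Icc 1 n, ((i : ℝ) + a)⁻¹)) atTop
      (𝓝 (Real.Gamma (a + 1))) := by
  rw [Real.Gamma_add_one ha.ne']
  refine ((Real.GammaSeq_tendsto_Gamma a).const_mul a).congr fun n => ?_
  rw [Real.GammaSeq, Finset.prod_range_succ', Finset.prod_inv_distrib, ← Finset.Ico_succ_right_eq_Icc,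
    Finset.prod_Ico_eq_prod_range]
  simp only [Nat.succ_eq_succ, Nat.succ_eq_add_one, Nat.add_sub_cancel]
  have h1 : ∏ i ∈ Finset.range n, (((1 + i : ℕ) : ℝ) + a) =
      ∏ i ∈ Finset.range n, (a + ((i + 1 : ℕ) : ℝ)) :=
    Finset.prod_congr rfl fun i _ => by push_cast; ring
  rw [h1]
  have h2 : ∏ i ∈ Finset.range n, (a + ((i + 1 : ℕ) : ℝ)) ≠ 0 :=
    Finset.prod_ne_zero_iff.2 fun i _ => by positivity
  push_cast at h2 ⊢
  field_simp
  ring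

theorem nuSM_eq_div (p : ℝ) {k : ℕ} (hk : 1 ≤ k) :
    nuSM k p = (2 - p) / (1 - p) / k *
      ((k ! : ℝ) * ∏ i ∈ Finset.Icc 1 k, ((i : ℝ) + (2 - p) / (1 - p))⁻¹) := by
  obtain ⟨m, rfl⟩ := Nat.exists_eq_add_of_le' hk
  rw [nuSM, Nat.add_sub_cancel, Nat.factorial_succ]
  push_cast
  have : (m : ℝ) + 1 ≠ 0 := by positivity
  field_simp

theorem nuSM_ratio_pos {p : ℝ} (hp1 : p < 1) : 0 < (2 - p) / (1 - p) :=
  div_pos (by linarith) (by linarith)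

theorem nuSM_nonneg {p : ℝ} (hp1 : p < 1) (k : ℕ) : 0 ≤ nuSM k p := by
  have := nuSM_ratio_pos hp1
  rw [nuSM]
  exact mul_nonneg (by positivity) (Finset.prod_nonneg fun i _ => by positivity)

theorem hasSum_nuSM {p : ℝ} (hp1 : p < 1) : HasSum (fun k : ℕ => nuSM (k + 1) p) 1 := by
  have ha := nuSM_ratio_pos hp1
  rw [hasSum_iff_tendsto_nat_of_nonneg fun k => nuSM_nonneg hp1 _]
  set a := (2 - p) / (1 - p) with ha'
  set T : ℕ → ℝ := fun n => (n ! : ℝ) * ∏ i ∈ Finset.Icc 1 n, ((i : ℝ) + a)⁻¹ with hT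
  -- Telescoping: `T (n + 1) = T n * (n + 1) / (n + 1 + a)`, so the drop is `T n * a / (n + 1 + a)`.
  have hstep : ∀ n, nuSM (n + 1) p = T n - T (n + 1) := by
    intro n
    have h1 : ∏ i ∈ Finset.Icc 1 (n + 1), ((i : ℝ) + a)⁻¹ =
        (∏ i ∈ Finset.Icc 1 n, ((i : ℝ) + a)⁻¹) * (((n + 1 : ℕ) : ℝ) + a)⁻¹ :=
      Finset.prod_Icc_succ_top (by omega) _
    simp only [nuSM, hT, ← ha', h1, Nat.add_sub_cancel, Nat.factorial_succ]
    push_cast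
    have : (n : ℝ) + 1 + a ≠ 0 := by positivity
    field_simp
    ring
  have hsum : ∀ n, ∑ k ∈ Finset.range n, nuSM (k + 1) p = 1 - T n := by
    intro n
    simp only [hstep]
    rw [Finset.sum_range_sub']
    simp [hT]
  have hT0 : Tendsto T atTop (𝓝 0) := by
    have h1 := (tendsto_rpow_neg_atTop ha).comp tendsto_natCast_atTop_atTop
    have h2 := h1.mul (tendsto_rpow_mul_factorial_mul_prod ha)
    rw [zero_mul] at h2
    refine h2.congr' ?_
    filter_upwards [eventually_gt_atTop 0] with n hn
    have hn' : (0 : ℝ) < n := by exact_mod_cast hn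
    rw [Function.comp_apply, ← mul_assoc, ← Real.rpow_add hn', neg_add_cancel, Real.rpow_zero,
      one_mul]
  simp only [hsum]
  simpa using hT0.const_sub 1

theorem nuSM_isEquivalent {p : ℝ} (hp1 : p < 1) :
    (fun k : ℕ => nuSM k p) ~[atTop]
      (fun k : ℕ => (2 - p) / (1 - p) * Real.Gamma ((3 - 2 * p) / (1 - p)) *
        (k : ℝ) ^ (-((3 - 2 * p) / (1 - p)))) := by
  have ha := nuSM_ratio_pos hp1
  have h1p : 1 - p ≠ 0 := by linarith
  have hα : (3 - 2 * p) / (1 - p) = (2 - p) / (1 - p) + 1 := by field_simp; ring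
  rw [hα]
  set a := (2 - p) / (1 - p) with ha'
  have hΓ : Real.Gamma (a + 1) ≠ 0 := (Real.Gamma_pos_of_pos (by positivity)).ne'
  refine (isEquivalent_iff_tendsto_one ?_).2 ?_
  · filter_upwards [eventually_gt_atTop 0] with k hk
    have : (0 : ℝ) < k := by exact_mod_cast hk
    have := Real.rpow_pos_of_pos this (-(a + 1))
    positivity
  · have h := (tendsto_rpow_mul_factorial_mul_prod ha).div_const (Real.Gamma (a + 1))
    rw [div_self hΓ] at h
    refine h.congr' ?_
    filter_upwards [eventually_gt_atTop 0] with k hk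
    have hk' : (0 : ℝ) < k := by exact_mod_cast hk
    have := Real.rpow_pos_of_pos hk' a
    rw [Pi.div_apply, nuSM_eq_div p hk, ← ha', Real.rpow_neg hk'.le, Real.rpow_add hk',
      Real.rpow_one]
    field_simp

/-- The recursion satisfied by the limiting degree distribution. -/
theorem nuSM_succ {p : ℝ} (hp1 : p < 1) (k : ℕ) :
    nuSM (k + 1) p = ((1 - p) * (k * nuSM k p) / (2 - p) + (if k = 0 then 1 else 0)) /
      (1 + (1 - p) * (k + 1 : ℕ) / (2 - p)) := by
  have h1 : 1 - p ≠ 0 := by linarith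
  have h2 : 2 - p ≠ 0 := by linarith
  have h1' : 0 < 1 - p := by linarith
  have h2' : 0 < 2 - p := by linarith
  have h3 : 1 + (1 - p) * (k + 1 : ℕ) / (2 - p) ≠ 0 := by positivity
  have ha := nuSM_ratio_pos hp1
  have h4 : ((k + 1 : ℕ) : ℝ) + (2 - p) / (1 - p) ≠ 0 := by positivity
  have h5 : (1 + (1 - p) * (k + 1 : ℕ) / (2 - p)) * ((2 - p) / (1 - p)) =
      ((k + 1 : ℕ) : ℝ) + (2 - p) / (1 - p) := by
    field_simp
    ring
  rw [eq_div_iff h3]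
  simp only [nuSM]
  rw [Finset.prod_Icc_succ_top (by omega), ← h5, mul_inv]
  -- For `k = 0` the junk value `nuSM 0 p` is multiplied by 0; the source term 1 replaces it.
  rcases k with _ | k
  · simp at h3 ⊢
    field_simp
  · simp only [Nat.add_sub_cancel, Nat.factorial_succ, Nat.succ_ne_zero, if_false, add_zero]
    push_cast at h3 ⊢
    field_simp

/-! ### One attachment step: degree bookkeeping and conditional means. -/

section Graph

variable {n : ℕ}

theorem attach_adj_castSucc_castSucc (g : SimpleGraph (Fin n)) (i j k : Fin n) :
    (attach g i).Adj j.castSucc k.castSucc ↔ g.Adj j k := by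
  simp [attach, SimpleGraph.edge_adj, SimpleGraph.map_adj', Fin.castSucc_ne_last]
  exact fun h => h.ne

theorem attach_adj_castSucc_last (g : SimpleGraph (Fin n)) (i j : Fin n) :
    (attach g i).Adj j.castSucc (Fin.last n) ↔ j = i := by
  simp [attach, SimpleGraph.edge_adj, SimpleGraph.map_adj', Fin.castSucc_ne_last]

/-- The sole neighbour of the new vertex recovers the choice; hence different choices give disjoint
events. -/
theorem attach_injective (g : SimpleGraph (Fin n)) : Function.Injective (attach g) := by
  intro i j h
  have h1 := (attach_adj_castSucc_last g i i).2 rfl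
  rw [h] at h1
  exact (attach_adj_castSucc_last g j i).1 h1

open Classical in
theorem deg_eq_sum (g : SimpleGraph (Fin n)) (v : Fin n) :
    deg g v = ∑ w, if g.Adj v w then 1 else 0 := by
  rw [deg, Finset.sum_boole, Nat.cast_id, ← SimpleGraph.card_neighborFinset_eq_degree]
  congr 1
  ext w
  simp

open Classical in
theorem deg_attach_castSucc (g : SimpleGraph (Fin n)) (i j : Fin n) :
    deg (attach g i) j.castSucc = deg g j + if j = i then 1 else 0 := by
  simp only [deg_eq_sum, Fin.sum_univ_castSucc, attach_adj_castSucc_castSucc,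
    attach_adj_castSucc_last]

theorem deg_attach_last (g : SimpleGraph (Fin n)) (i : Fin n) :
    deg (attach g i) (Fin.last n) = 1 := by
  classical
  rw [deg_eq_sum, Fin.sum_univ_castSucc]
  simp [SimpleGraph.adj_comm _ (Fin.last n), attach_adj_castSucc_last]

theorem nonSuperstarDegreeSum_eq_sum (g : SimpleGraph (Fin n)) :
    nonSuperstarDegreeSum g = ∑ j : Fin n, if (j : ℕ) ≠ 0 then deg g j else 0 := by
  rw [nonSuperstarDegreeSum, Finset.sum_filter]

theorem nonSuperstarDegreeSum_attach (hn : n ≠ 0) (g : SimpleGraph (Fin n)) (i : Fin n) :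
    nonSuperstarDegreeSum (attach g i) =
      nonSuperstarDegreeSum g + 1 + if (i : ℕ) ≠ 0 then 1 else 0 := by
  classical
  simp only [nonSuperstarDegreeSum_eq_sum, Fin.sum_univ_castSucc, deg_attach_castSucc,
    deg_attach_last, Fin.val_castSucc, Fin.val_last, if_pos hn]
  have h : ∀ j : Fin n, (if (j : ℕ) ≠ 0 then deg g j + (if j = i then 1 else 0) else 0) =
      (if (j : ℕ) ≠ 0 then deg g j else 0) +
        if j = i then (if (i : ℕ) ≠ 0 then 1 else 0) else 0 := by
    intro j
    by_cases hj : j = i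
    · subst hj; split_ifs <;> rfl
    · simp [hj]
  simp only [h, Finset.sum_add_distrib, Finset.sum_ite_eq', Finset.mem_univ, if_true]
  ring

theorem nonSuperstarDegreeSum_top_two : nonSuperstarDegreeSum (⊤ : SimpleGraph (Fin 2)) = 1 := by
  classical
  rw [nonSuperstarDegreeSum_eq_sum]
  simp [Fin.sum_univ_two, deg_eq_sum]

theorem nonSuperstarCount_eq_sum (g : SimpleGraph (Fin n)) (k : ℕ) :
    nonSuperstarCount g k = ∑ j : Fin n, if (j : ℕ) ≠ 0 ∧ deg g j = k then 1 else 0 := by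
  rw [nonSuperstarCount, Finset.sum_boole, Nat.cast_id, ← Set.ncard_coe_finset]
  simp

/-- Only the chosen vertex changes degree, and the new vertex has degree 1, whence the term for `k =
0`. The cast to ℝ avoids truncated subtraction. -/
theorem cast_nonSuperstarCount_attach (hn : n ≠ 0) (g : SimpleGraph (Fin n)) (i : Fin n) (k : ℕ) :
    (nonSuperstarCount (attach g i) (k + 1) : ℝ) = nonSuperstarCount g (k + 1) +
      (if k = 0 then 1 else 0) + ((if (i : ℕ) ≠ 0 ∧ deg g i = k then 1 else 0) -
        (if (i : ℕ) ≠ 0 ∧ deg g i = k + 1 then 1 else 0)) := by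
  classical
  simp only [nonSuperstarCount_eq_sum, Fin.sum_univ_castSucc, deg_attach_castSucc,
    deg_attach_last, Fin.val_castSucc, Fin.val_last]
  push_cast
  have h : ∀ j : Fin n,
      (if (j : ℕ) ≠ 0 ∧ deg g j + (if j = i then 1 else 0) = k + 1 then (1 : ℝ) else 0) =
      (if (j : ℕ) ≠ 0 ∧ deg g j = k + 1 then 1 else 0) +
        if j = i then ((if (i : ℕ) ≠ 0 ∧ deg g i = k then 1 else 0) -
        (if (i : ℕ) ≠ 0 ∧ deg g i = k + 1 then 1 else 0)) else 0 := by
    intro j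
    by_cases hj : j = i
    · subst hj; simp
    · simp [hj]
  simp only [h, Finset.sum_add_distrib, Finset.sum_ite_eq', Finset.mem_univ, if_true]
  simp only [ne_eq, hn, not_false_eq_true, true_and]
  ring

theorem attachProb_nonneg {p : ℝ} (hp0 : 0 < p) (hp1 : p < 1) (g : SimpleGraph (Fin n))
    (i : Fin n) : 0 ≤ attachProb p g i := by
  rw [attachProb]
  have : 0 < 1 - p := by linarith
  split_ifs <;> positivity

theorem sum_attachProb_mul_nonSuperstar (p : ℝ) (g : SimpleGraph (Fin n)) (f : Fin n → ℝ) :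
    ∑ i : Fin n, attachProb p g i * (if (i : ℕ) ≠ 0 then f i else 0) =
      (1 - p) / nonSuperstarDegreeSum g * ∑ i : Fin n, if (i : ℕ) ≠ 0 then deg g i * f i else 0 := by
  rw [Finset.mul_sum]
  refine Finset.sum_congr rfl fun i _ => ?_
  rw [attachProb]
  split_ifs <;> first | contradiction | ring

theorem sum_attachProb_nonSuperstar (p : ℝ) (g : SimpleGraph (Fin n))
    (hg : nonSuperstarDegreeSum g ≠ 0) :
    ∑ i : Fin n, attachProb p g i * (if (i : ℕ) ≠ 0 then 1 else 0) = 1 - p := by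
  have hg' : (nonSuperstarDegreeSum g : ℝ) ≠ 0 := by exact_mod_cast hg
  rw [sum_attachProb_mul_nonSuperstar]
  have : ∑ i : Fin n, (if (i : ℕ) ≠ 0 then (deg g i : ℝ) * 1 else 0) = nonSuperstarDegreeSum g := by
    rw [nonSuperstarDegreeSum_eq_sum]
    push_cast
    simp only [mul_one]
  rw [this]
  field_simp

theorem sum_attachProb (p : ℝ) (hn : n ≠ 0) (g : SimpleGraph (Fin n))
    (hg : nonSuperstarDegreeSum g ≠ 0) : ∑ i, attachProb p g i = 1 := by
  have h : ∀ i : Fin n, attachProb p g i =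
      attachProb p g i * (if (i : ℕ) ≠ 0 then 1 else 0) +
        if i = ⟨0, Nat.pos_of_ne_zero hn⟩ then p else 0 := by
    intro i
    by_cases hi : (i : ℕ) = 0
    · simp [hi, attachProb, Fin.ext_iff]
    · simp [hi, Fin.ext_iff]
  rw [Finset.sum_congr rfl fun i _ => h i, Finset.sum_add_distrib,
    sum_attachProb_nonSuperstar p g hg]
  simp

theorem sum_attachProb_deg_eq (p : ℝ) (g : SimpleGraph (Fin n)) (k : ℕ) :
    ∑ i : Fin n, attachProb p g i * (if (i : ℕ) ≠ 0 ∧ deg g i = k then 1 else 0) =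
      (1 - p) * k * nonSuperstarCount g k / nonSuperstarDegreeSum g := by
  have h := sum_attachProb_mul_nonSuperstar p g (fun i => if deg g i = k then 1 else 0)
  simp only [← ite_and] at h
  have h1 : ∑ i : Fin n, (if (i : ℕ) ≠ 0 then (deg g i : ℝ) * (if deg g i = k then 1 else 0) else 0) =
      k * nonSuperstarCount g k := by
    rw [nonSuperstarCount_eq_sum]
    push_cast
    rw [Finset.mul_sum]
    refine Finset.sum_congr rfl fun i _ => ?_
    by_cases h2 : (i : ℕ) ≠ 0 <;> by_cases h3 : deg g i = k <;> simp [h2, h3]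
  rw [h, h1]
  ring

/-- Conditional mean of `F` of the next graph when the current graph is `g`. -/
noncomputable def stepMean (p : ℝ) (F : SimpleGraph (Fin (n + 1)) → ℝ) (g : SimpleGraph (Fin n)) :
    ℝ :=
  ∑ i, attachProb p g i * F (attach g i)

theorem abs_stepMean_sub_le {p : ℝ} (hp0 : 0 < p) (hp1 : p < 1) (hn : n ≠ 0)
    (g : SimpleGraph (Fin n)) (hg : nonSuperstarDegreeSum g ≠ 0)
    (F : SimpleGraph (Fin (n + 1)) → ℝ) {x C : ℝ} (h : ∀ i, |F (attach g i) - x| ≤ C) :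
    |stepMean p F g - x| ≤ C := by
  have h1 := sum_attachProb p hn g hg
  have h2 : stepMean p F g - x = ∑ i, attachProb p g i * (F (attach g i) - x) := by
    simp only [mul_sub, Finset.sum_sub_distrib, ← Finset.sum_mul, h1, one_mul, stepMean]
  calc |stepMean p F g - x| ≤ ∑ i, |attachProb p g i * (F (attach g i) - x)| := by
        rw [h2]; exact Finset.abs_sum_le_sum_abs _ _
    _ ≤ ∑ i, attachProb p g i * C := by
        refine Finset.sum_le_sum fun i _ => ?_
        rw [abs_mul, abs_of_nonneg (attachProb_nonneg hp0 hp1 g i)]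
        exact mul_le_mul_of_nonneg_left (h i) (attachProb_nonneg hp0 hp1 g i)
    _ = C := by rw [← Finset.sum_mul, h1, one_mul]

theorem stepMean_nonSuperstarDegreeSum (p : ℝ) (hn : n ≠ 0) (g : SimpleGraph (Fin n))
    (hg : nonSuperstarDegreeSum g ≠ 0) :
    stepMean p (fun g' => (nonSuperstarDegreeSum g' : ℝ)) g =
      nonSuperstarDegreeSum g + (2 - p) := by
  simp only [stepMean, nonSuperstarDegreeSum_attach hn]
  push_cast
  simp only [mul_add, Finset.sum_add_distrib, ← Finset.sum_mul, sum_attachProb p hn g hg,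
    sum_attachProb_nonSuperstar p g hg]
  ring

theorem stepMean_nonSuperstarCount (p : ℝ) (hn : n ≠ 0) (g : SimpleGraph (Fin n))
    (hg : nonSuperstarDegreeSum g ≠ 0) (k : ℕ) :
    stepMean p (fun g' => (nonSuperstarCount g' (k + 1) : ℝ)) g =
      nonSuperstarCount g (k + 1) + ((1 - p) * k * nonSuperstarCount g k / nonSuperstarDegreeSum g +
        if k = 0 then 1 else 0) -
        (1 - p) * (k + 1 : ℕ) / nonSuperstarDegreeSum g * nonSuperstarCount g (k + 1) := by
  simp only [stepMean, cast_nonSuperstarCount_attach hn, mul_add, mul_sub, Finset.sum_add_distrib,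
    Finset.sum_sub_distrib, ← Finset.sum_mul, sum_attachProb p hn g hg, sum_attachProb_deg_eq]
  ring

end Graph

/-! ### Histories, innovations and their orthogonality. -/

section RandomGraph

variable {Ω : Type*} {G : (n : ℕ) → Ω → SimpleGraph (Fin n)}

/-- The event that the graphs up to time `n` are given by `h`. -/
def historyEvent (G : (n : ℕ) → Ω → SimpleGraph (Fin n)) (n : ℕ)
    (h : (m : ℕ) → SimpleGraph (Fin m)) : Set Ω :=
  {ω | ∀ m ≤ n, G m ω = h m}

/-- The history `G 0, …, G n`, continued by empty graphs. -/
def historyUpTo (G : (n : ℕ) → Ω → SimpleGraph (Fin n)) (n : ℕ) (ω : Ω) :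
    (m : ℕ) → SimpleGraph (Fin m) :=
  fun m => if m ≤ n then G m ω else ⊥

/-- Filling the future with `⊥` leaves finitely many histories, so conditioning reduces to a finite
partition of Ω. -/
theorem finite_range_historyUpTo (G : (n : ℕ) → Ω → SimpleGraph (Fin n)) (n : ℕ) :
    (Set.range (historyUpTo G n)).Finite := by
  have h : Set.range (historyUpTo G n) ⊆ Set.range
      (fun (f : (m : Fin (n + 1)) → SimpleGraph (Fin m)) (m : ℕ) =>
        if hm : m < n + 1 then f ⟨m, hm⟩ else ⊥) := by
    rintro _ ⟨ω, rfl⟩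
    refine ⟨fun m => G m ω, funext fun m => ?_⟩
    by_cases hm : m ≤ n
    · simp [historyUpTo, hm, Nat.lt_succ_of_le hm]
    · simp [historyUpTo, hm]
  exact (Set.finite_range _).subset h

theorem mem_historyEvent_historyUpTo (n : ℕ) (ω : Ω) :
    ω ∈ historyEvent G n (historyUpTo G n ω) := fun m hm => by simp [historyUpTo, hm]

theorem historyUpTo_eq_of_mem {n : ℕ} {h : (m : ℕ) → SimpleGraph (Fin m)} {ω ω' : Ω}
    (hω : ω ∈ historyEvent G n h) (hω' : ω' ∈ historyEvent G n h) :
    historyUpTo G n ω = historyUpTo G n ω' := by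
  funext m
  by_cases hm : m ≤ n
  · simp [historyUpTo, hm, hω m hm, hω' m hm]
  · simp [historyUpTo, hm]

variable [MeasurableSpace Ω] {μ : Measure Ω} {p : ℝ}

theorem IsSuperstarProcess.measurableSet_historyEvent (hG : IsSuperstarProcess μ p G) (n : ℕ)
    (h : (m : ℕ) → SimpleGraph (Fin m)) : MeasurableSet (historyEvent G n h) := by
  have : historyEvent G n h = ⋂ m : ℕ, ⋂ _ : m ≤ n, {ω | G m ω = h m} := by
    ext ω; simp [historyEvent]
  rw [this]
  exact MeasurableSet.iInter fun m => MeasurableSet.iInter fun _ => hG.measurableSet_eq m _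

theorem IsSuperstarProcess.measurable_comp (hG : IsSuperstarProcess μ p G) (n : ℕ)
    (F : SimpleGraph (Fin n) → ℝ) : Measurable (fun ω => F (G n ω)) := by
  let : MeasurableSpace (SimpleGraph (Fin n)) := ⊤
  have h1 : Measurable (G n) := measurable_to_countable' fun g => hG.measurableSet_eq n g
  exact (measurable_from_top (f := F)).comp h1

theorem ae_of_forall_historyEvent {n : ℕ} {P : Ω → Prop}
    (h : ∀ h : (m : ℕ) → SimpleGraph (Fin m), ∀ᵐ ω ∂μ, ω ∈ historyEvent G n h → P ω) :
    ∀ᵐ ω ∂μ, P ω := by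
  have h1 : ∀ᵐ ω ∂μ, ∀ f ∈ Set.range (historyUpTo G n), ω ∈ historyEvent G n f → P ω :=
    (ae_ball_iff (finite_range_historyUpTo G n).countable).2 fun f _ => h f
  filter_upwards [h1] with ω hω
  exact hω _ ⟨ω, rfl⟩ (mem_historyEvent_historyUpTo n ω)

/-- The deviation of `F` of the next graph from its conditional mean. -/
noncomputable def innovation (p : ℝ) (G : (n : ℕ) → Ω → SimpleGraph (Fin n))
    (F : (n : ℕ) → SimpleGraph (Fin n) → ℝ) (n : ℕ) (ω : Ω) : ℝ :=
  F (n + 1) (G (n + 1) ω) - stepMean p (F (n + 1)) (G n ω)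

theorem IsSuperstarProcess.measurable_innovation (hG : IsSuperstarProcess μ p G)
    (F : (n : ℕ) → SimpleGraph (Fin n) → ℝ) (n : ℕ) : Measurable (innovation p G F n) :=
  (hG.measurable_comp _ _).sub (hG.measurable_comp _ _)

variable [IsProbabilityMeasure μ]

/-- The part of a history event where the next vertex is attached to some vertex has full measure. -/
theorem IsSuperstarProcess.iUnion_attach_ae_eq (hG : IsSuperstarProcess μ p G)
    (hp0 : 0 < p) (hp1 : p < 1) {n : ℕ} (hn : 2 ≤ n) (h : (m : ℕ) → SimpleGraph (Fin m))
    (hS : nonSuperstarDegreeSum (h n) ≠ 0) :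
    (⋃ i, historyEvent G n h ∩ {ω | G (n + 1) ω = attach (h n) i} : Set Ω) =ᵐ[μ]
      historyEvent G n h := by
  have hmeas : ∀ i, MeasurableSet (historyEvent G n h ∩ {ω | G (n + 1) ω = attach (h n) i}) :=
    fun i => (hG.measurableSet_historyEvent n h).inter (hG.measurableSet_eq _ _)
  refine ae_eq_of_subset_of_measure_ge (Set.iUnion_subset fun i => Set.inter_subset_left) ?_
    (MeasurableSet.iUnion hmeas).nullMeasurableSet (measure_ne_top _ _)
  rw [measure_iUnion _ hmeas, tsum_fintype]
  · have h1 : ∀ i, μ (historyEvent G n h ∩ {ω | G (n + 1) ω = attach (h n) i}) =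
        μ (historyEvent G n h) * ENNReal.ofReal (attachProb p (h n) i) := hG.step n hn h
    simp only [h1, ← Finset.mul_sum]
    rw [← ENNReal.ofReal_sum_of_nonneg fun i _ => attachProb_nonneg hp0 hp1 _ i,
      sum_attachProb p (by omega) _ hS, ENNReal.ofReal_one, mul_one]
  · intro i j hij
    refine Set.disjoint_left.2 fun ω hi hj => hij ?_
    exact attach_injective _ (hi.2.symm.trans hj.2)

theorem IsSuperstarProcess.ae_attach_of_ae_ne_zero (hG : IsSuperstarProcess μ p G)
    (hp0 : 0 < p) (hp1 : p < 1) {n : ℕ} (hn : 2 ≤ n)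
    (hS : ∀ᵐ ω ∂μ, nonSuperstarDegreeSum (G n ω) ≠ 0) :
    ∀ᵐ ω ∂μ, ∃ i, G (n + 1) ω = attach (G n ω) i := by
  refine ae_of_forall_historyEvent (G := G) (n := n) fun h => ?_
  by_cases hS' : nonSuperstarDegreeSum (h n) = 0
  · filter_upwards [hS] with ω hω hω'
    rw [hω' n le_rfl] at hω
    exact absurd hS' hω
  · filter_upwards [(hG.iUnion_attach_ae_eq hp0 hp1 hn h hS').mem_iff] with ω hω hω'
    obtain ⟨i, hi⟩ := Set.mem_iUnion.1 (hω.2 hω')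
    exact ⟨i, by rw [hω' n le_rfl]; exact hi.2⟩

/-- If the degree sum were 0, division by zero would leave total attachment probability `p` rather
than 1. The sum is 1 at time 2, and each attachment increases it. -/
theorem IsSuperstarProcess.ae_nonSuperstarDegreeSum_ne_zero (hG : IsSuperstarProcess μ p G)
    (hp0 : 0 < p) (hp1 : p < 1) {n : ℕ} (hn : 2 ≤ n) :
    ∀ᵐ ω ∂μ, nonSuperstarDegreeSum (G n ω) ≠ 0 := by
  induction n, hn using Nat.le_induction with
  | base =>
    filter_upwards [hG.two] with ω hω
    rw [hω, nonSuperstarDegreeSum_top_two]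
    exact one_ne_zero
  | succ n hn ih =>
    filter_upwards [hG.ae_attach_of_ae_ne_zero hp0 hp1 hn ih] with ω ⟨i, hi⟩
    rw [hi, nonSuperstarDegreeSum_attach (by omega)]
    omega

theorem IsSuperstarProcess.ae_attach (hG : IsSuperstarProcess μ p G)
    (hp0 : 0 < p) (hp1 : p < 1) {n : ℕ} (hn : 2 ≤ n) :
    ∀ᵐ ω ∂μ, ∃ i, G (n + 1) ω = attach (G n ω) i :=
  hG.ae_attach_of_ae_ne_zero hp0 hp1 hn (hG.ae_nonSuperstarDegreeSum_ne_zero hp0 hp1 hn)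

theorem IsSuperstarProcess.integrable_comp (hG : IsSuperstarProcess μ p G) (n : ℕ)
    (F : SimpleGraph (Fin n) → ℝ) : Integrable (fun ω => F (G n ω)) μ := by
  refine Integrable.of_bound (hG.measurable_comp n F).aestronglyMeasurable (∑ g, |F g|)
    (Eventually.of_forall fun ω => ?_)
  exact Finset.single_le_sum (f := fun g => |F g|) (fun _ _ => abs_nonneg _) (Finset.mem_univ _)

/-- The martingale difference property, on one history: split by the chosen vertex and use the
attachment probabilities. Histories with degree sum 0 are null. -/
theorem IsSuperstarProcess.setIntegral_innovation (hG : IsSuperstarProcess μ p G)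
    (hp0 : 0 < p) (hp1 : p < 1) (F : (n : ℕ) → SimpleGraph (Fin n) → ℝ) {n : ℕ} (hn : 2 ≤ n)
    (h : (m : ℕ) → SimpleGraph (Fin m)) :
    ∫ ω in historyEvent G n h, innovation p G F n ω ∂μ = 0 := by
  have hA := hG.measurableSet_historyEvent n h
  by_cases hS : nonSuperstarDegreeSum (h n) = 0
  · refine setIntegral_measure_zero _ (measure_mono_null (fun ω hω => ?_)
      (hG.ae_nonSuperstarDegreeSum_ne_zero hp0 hp1 hn))
    rw [← hω n le_rfl] at hS
    exact fun h' => h' hS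
  have hB : ∀ i, MeasurableSet (historyEvent G n h ∩ {ω | G (n + 1) ω = attach (h n) i}) :=
    fun i => hA.inter (hG.measurableSet_eq _ _)
  have hreal : ∀ i, μ.real (historyEvent G n h ∩ {ω | G (n + 1) ω = attach (h n) i}) =
      μ.real (historyEvent G n h) * attachProb p (h n) i := by
    intro i
    have h1 : μ (historyEvent G n h ∩ {ω | G (n + 1) ω = attach (h n) i}) =
        μ (historyEvent G n h) * ENNReal.ofReal (attachProb p (h n) i) := hG.step n hn h i
    rw [measureReal_def, h1, ENNReal.toReal_mul,
      ENNReal.toReal_ofReal (attachProb_nonneg hp0 hp1 _ i), measureReal_def]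
  have h1 : ∫ ω in historyEvent G n h, F (n + 1) (G (n + 1) ω) ∂μ =
      μ.real (historyEvent G n h) * stepMean p (F (n + 1)) (h n) := by
    rw [← setIntegral_congr_set (hG.iUnion_attach_ae_eq hp0 hp1 hn h hS),
      integral_iUnion_fintype hB
        (fun i j hij => Set.disjoint_left.2 fun ω hi hj =>
          hij (attach_injective _ (hi.2.symm.trans hj.2)))
        fun i => (hG.integrable_comp _ _).integrableOn, stepMean, Finset.mul_sum]
    refine Finset.sum_congr rfl fun i _ => ?_
    rw [setIntegral_congr_fun (g := fun _ => F (n + 1) (attach (h n) i)) (hB i)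
      fun ω hω => congrArg (F (n + 1)) hω.2, setIntegral_const, hreal, smul_eq_mul, mul_assoc]
  have h2 : ∫ ω in historyEvent G n h, stepMean p (F (n + 1)) (G n ω) ∂μ =
      μ.real (historyEvent G n h) * stepMean p (F (n + 1)) (h n) := by
    rw [setIntegral_congr_fun (g := fun _ => stepMean p (F (n + 1)) (h n)) hA
      fun ω hω => congrArg (stepMean p (F (n + 1))) (hω n le_rfl), setIntegral_const, smul_eq_mul]
  simp only [innovation]
  rw [integral_sub (hG.integrable_comp _ _).integrableOn (hG.integrable_comp _ _).integrableOn,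
    h1, h2, sub_self]

theorem IsSuperstarProcess.integrable_innovation (hG : IsSuperstarProcess μ p G)
    (F : (n : ℕ) → SimpleGraph (Fin n) → ℝ) (n : ℕ) : Integrable (innovation p G F n) μ :=
  (hG.integrable_comp _ _).sub (hG.integrable_comp _ (stepMean p (F (n + 1))))

theorem IsSuperstarProcess.integral_mul_innovation (hG : IsSuperstarProcess μ p G)
    (hp0 : 0 < p) (hp1 : p < 1) (F : (n : ℕ) → SimpleGraph (Fin n) → ℝ) {m n : ℕ} (hm : 2 ≤ m)
    (hmn : m < n) : ∫ ω, innovation p G F m ω * innovation p G F n ω ∂μ = 0 := by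
  set s := (finite_range_historyUpTo G n).toFinset
  have huniv : (⋃ f ∈ s, {ω | historyUpTo G n ω = f}) = Set.univ := by
    ext ω; simp [s]
  have hevent : ∀ ω₀, {ω | historyUpTo G n ω = historyUpTo G n ω₀} =
      historyEvent G n (historyUpTo G n ω₀) := by
    intro ω₀
    ext ω
    refine ⟨fun h => ?_, fun h => ?_⟩
    · have h' : historyUpTo G n ω = historyUpTo G n ω₀ := h
      rw [← h']
      exact mem_historyEvent_historyUpTo n ω
    · exact historyUpTo_eq_of_mem h (mem_historyEvent_historyUpTo n ω₀)
  have hmeas : ∀ f ∈ s, MeasurableSet {ω | historyUpTo G n ω = f} := by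
    intro f hf
    obtain ⟨ω₀, rfl⟩ := (Set.Finite.mem_toFinset _).1 hf
    rw [hevent]
    exact hG.measurableSet_historyEvent n _
  have hzero : ∀ f ∈ s, IntegrableOn (fun ω => innovation p G F m ω * innovation p G F n ω)
      {ω | historyUpTo G n ω = f} μ ∧ ∫ ω in {ω | historyUpTo G n ω = f},
        innovation p G F m ω * innovation p G F n ω ∂μ = 0 := by
    intro f hf
    obtain ⟨ω₀, rfl⟩ := (Set.Finite.mem_toFinset _).1 hf
    have hA := hmeas _ hf
    -- Since `m + 1 ≤ n`, the earlier innovation is determined by the history up to `n` and is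
    -- constant on each cell.
    have hconst : Set.EqOn (fun ω => innovation p G F m ω * innovation p G F n ω)
        (fun ω => innovation p G F m ω₀ * innovation p G F n ω)
        {ω | historyUpTo G n ω = historyUpTo G n ω₀} := by
      intro ω hω
      have h1 : ∀ j ≤ n, G j ω = G j ω₀ := by
        intro j hj
        have := congrFun hω j
        simpa [historyUpTo, hj] using this
      simp only [innovation, h1 m hmn.le, h1 (m + 1) hmn]
    refine ⟨((hG.integrable_innovation F n).const_mul _).integrableOn.congr_fun hconst.symm hA, ?_⟩
    rw [setIntegral_congr_fun hA hconst, integral_const_mul, hevent,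
      hG.setIntegral_innovation hp0 hp1 F (by omega), mul_zero]
  rw [← setIntegral_univ, ← huniv, integral_biUnion_finset s hmeas ?_ fun f hf => (hzero f hf).1]
  · exact Finset.sum_eq_zero fun f hf => (hzero f hf).2
  · intro f _ f' _ hff
    exact Set.disjoint_left.2 fun ω h h' => hff (h.symm.trans h')

/-- The innovations of a graph functional with bounded increments average to zero. -/
theorem IsSuperstarProcess.ae_tendsto_sum_innovation_div (hG : IsSuperstarProcess μ p G)
    (hp0 : 0 < p) (hp1 : p < 1) (F : (n : ℕ) → SimpleGraph (Fin n) → ℝ) {C : ℝ}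
    (hF : ∀ n, n ≠ 0 → ∀ (g : SimpleGraph (Fin n)) i, |F (n + 1) (attach g i) - F n g| ≤ C) :
    ∀ᵐ ω ∂μ, Tendsto
      (fun n : ℕ => (∑ i ∈ Finset.range n, innovation p G F (i + 2) ω) / (n : ℝ)) atTop (𝓝 0) := by
  -- One `C` bounds the actual increment, the other its conditional mean. The index shift by 2
  -- reflects that the attachment rule starts at time 2.
  refine ae_tendsto_sum_div_of_orthogonal (C := C + C)
    (fun n => hG.measurable_innovation F (n + 2)) (fun n => ?_)
    fun i j hij => hG.integral_mul_innovation hp0 hp1 F (by omega) (by omega)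
  filter_upwards [hG.ae_attach hp0 hp1 (n := n + 2) (by omega),
    hG.ae_nonSuperstarDegreeSum_ne_zero hp0 hp1 (n := n + 2) (by omega)] with ω ⟨i, hi⟩ hS
  have h1 := hF (n + 2) (by omega) (G (n + 2) ω) i
  have h2 := abs_stepMean_sub_le hp0 hp1 (by omega) _ hS (F (n + 2 + 1))
    (hF (n + 2) (by omega) (G (n + 2) ω))
  rw [← hi] at h1
  rw [innovation, ← sub_sub_sub_cancel_right _ _ (F (n + 2) (G (n + 2) ω))]
  exact (abs_sub _ _).trans (add_le_add h1 h2)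

/-! ### Almost sure limits. -/

theorem IsSuperstarProcess.ae_tendsto_nonSuperstarDegreeSum_div (hG : IsSuperstarProcess μ p G)
    (hp0 : 0 < p) (hp1 : p < 1) :
    ∀ᵐ ω ∂μ, Tendsto (fun n : ℕ => (nonSuperstarDegreeSum (G (n + 2) ω) : ℝ) / (n : ℝ)) atTop
      (𝓝 (2 - p)) := by
  have h1 := hG.ae_tendsto_sum_innovation_div hp0 hp1
    (fun n g => (nonSuperstarDegreeSum g : ℝ)) (C := 2) (by
      intro n hn g i
      rw [nonSuperstarDegreeSum_attach hn]
      push_cast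
      rw [add_assoc, add_sub_cancel_left]
      split_ifs <;> norm_num)
  have h2 := ae_all_iff.2 fun n : ℕ =>
    hG.ae_nonSuperstarDegreeSum_ne_zero hp0 hp1 (n := n + 2) (by omega)
  filter_upwards [h1, h2] with ω h1 h2
  have h3 := tendsto_div_of_recursion (x := fun n => (nonSuperstarDegreeSum (G (n + 2) ω) : ℝ))
    (b := fun _ => 2 - p) (c := fun _ => 0) (b₀ := 2 - p) (c₀ := 0) le_rfl (fun _ => le_rfl)
    (by simp) tendsto_const_nhds h1 (by
      intro n
      rw [innovation, stepMean_nonSuperstarDegreeSum p (by omega) _ (h2 n)]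
      ring_nf)
  simpa using h3

/-- The induction step on the degree. The factor `k` in `hprev` makes the case `k = 0` trivial, so
no separate argument for degree 1 is needed. -/
theorem IsSuperstarProcess.ae_tendsto_nonSuperstarCount_div_of_pred
    (hG : IsSuperstarProcess μ p G) (hp0 : 0 < p) (hp1 : p < 1) (k : ℕ)
    (hprev : ∀ᵐ ω ∂μ, Tendsto
      (fun n : ℕ => k * ((nonSuperstarCount (G (n + 2) ω) k : ℝ) / n)) atTop
      (𝓝 (k * nuSM k p))) :
    ∀ᵐ ω ∂μ, Tendsto (fun n : ℕ => (nonSuperstarCount (G (n + 2) ω) (k + 1) : ℝ) / (n : ℝ)) atTop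
      (𝓝 (nuSM (k + 1) p)) := by
  have hp : 0 < 1 - p := by linarith
  have h2p : 2 - p ≠ 0 := by linarith
  have h1 := hG.ae_tendsto_sum_innovation_div hp0 hp1
    (fun n g => (nonSuperstarCount g (k + 1) : ℝ)) (C := 2) (by
      intro n hn g i
      rw [cast_nonSuperstarCount_attach hn, add_assoc, add_sub_cancel_left]
      split_ifs <;> norm_num)
  have h2 := ae_all_iff.2 fun n : ℕ =>
    hG.ae_nonSuperstarDegreeSum_ne_zero hp0 hp1 (n := n + 2) (by omega)
  filter_upwards [h1, h2, hprev, hG.ae_tendsto_nonSuperstarDegreeSum_div hp0 hp1]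
    with ω h1 h2 hprev hS
  rw [nuSM_succ hp1]
  refine tendsto_div_of_recursion
    (x := fun n => (nonSuperstarCount (G (n + 2) ω) (k + 1) : ℝ))
    (b := fun n => (1 - p) * k * nonSuperstarCount (G (n + 2) ω) k /
      nonSuperstarDegreeSum (G (n + 2) ω) + if k = 0 then 1 else 0)
    (c := fun n => (1 - p) * (k + 1 : ℕ) / nonSuperstarDegreeSum (G (n + 2) ω))
    (div_nonneg (by positivity) (by linarith)) (fun n => by positivity) ?_ ?_ h1 fun n => ?_
  · refine ((tendsto_const_nhds (x := (1 - p) * ((k + 1 : ℕ) : ℝ))).div hS h2p).congr fun n => ?_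
    rw [Pi.div_apply, div_div_eq_mul_div]
    ring
  · refine (((hprev.const_mul (1 - p)).div hS h2p).add_const _).congr' ?_
    filter_upwards [eventually_gt_atTop 0] with n hn
    have hn' : (n : ℝ) ≠ 0 := by positivity
    have hS' : (nonSuperstarDegreeSum (G (n + 2) ω) : ℝ) ≠ 0 := by exact_mod_cast h2 n
    congr 1
    simp only [Pi.div_apply]
    field_simp
  · rw [innovation, stepMean_nonSuperstarCount p (by omega) _ (h2 n)]
    ring_nf

theorem IsSuperstarProcess.ae_tendsto_nonSuperstarCount_div (hG : IsSuperstarProcess μ p G)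
    (hp0 : 0 < p) (hp1 : p < 1) (k : ℕ) :
    ∀ᵐ ω ∂μ, Tendsto (fun n : ℕ => (nonSuperstarCount (G (n + 2) ω) (k + 1) : ℝ) / (n : ℝ)) atTop
      (𝓝 (nuSM (k + 1) p)) := by
  induction k with
  | zero => exact hG.ae_tendsto_nonSuperstarCount_div_of_pred hp0 hp1 0 (by simp)
  | succ k ih =>
    refine hG.ae_tendsto_nonSuperstarCount_div_of_pred hp0 hp1 (k + 1) ?_
    filter_upwards [ih] with ω hω using hω.const_mul _

end RandomGraph

end Superstar

/-- Degree distribution strong law for the Superstar Model. The graph `G (n + 1)` has exactly the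
`n` non-superstar vertices `v_1, …, v_n`. -/
theorem mainTheorem1 {Ω : Type*} [MeasurableSpace Ω] (μ : Measure Ω) [IsProbabilityMeasure μ]
    (p : ℝ) (hp0 : 0 < p) (hp1 : p < 1) (G : (n : ℕ) → Ω → SimpleGraph (Fin n))
    (hG : Superstar.IsSuperstarProcess μ p G) :
    (∀ᵐ ω ∂μ, ∀ k : ℕ, 1 ≤ k →
      Tendsto (fun n : ℕ => (1 / (n : ℝ)) * (Superstar.nonSuperstarCount (G (n + 1) ω) k : ℝ))
        atTop (𝓝 (Superstar.nuSM k p))) ∧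
    ((∀ k : ℕ, 1 ≤ k → 0 ≤ Superstar.nuSM k p) ∧
      HasSum (fun k : ℕ => Superstar.nuSM (k + 1) p) 1) ∧
    (fun k : ℕ => Superstar.nuSM k p) ~[atTop]
      (fun k : ℕ => (2 - p) / (1 - p) * Real.Gamma ((3 - 2 * p) / (1 - p)) *
        (k : ℝ) ^ (-((3 - 2 * p) / (1 - p)))) := by 
  refine ⟨?_, ⟨fun k _ => Superstar.nuSM_nonneg hp1 k, Superstar.hasSum_nuSM hp1⟩,
    Superstar.nuSM_isEquivalent hp1⟩
  filter_upwards [ae_all_iff.2 fun k => hG.ae_tendsto_nonSuperstarCount_div hp0 hp1 k]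
    with ω hω k hk
  obtain ⟨k, rfl⟩ := Nat.exists_eq_add_of_le' hk
  -- Shifting by one turns the graph into `G (n + 2)`; the normalisation `n + 1` in place of `n`
  -- costs a factor n/(n+1) → 1.
  refine (tendsto_add_atTop_iff_nat 1).1 ?_
  have h1 := (hω k).mul (tendsto_natCast_div_add_atTop (1 : ℝ))
  rw [mul_one] at h1
  refine h1.congr' ?_
  filter_upwards [eventually_gt_atTop 0] with n hn
  have hn' : (n : ℝ) ≠ 0 := by positivity
  push_cast
  field_simp
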